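/- **Conventions.** Graphs are finite and partially directed: any two distinct vertices are joined by at most one edge, directed ($a\to b$) or undirected ($a-b$), and there are no loops. For a vertex $x$ of a graph $\mathcal G$, $pa(x,\mathcal G)$, $ch(x,\mathcal G)$, $sib(x,\mathcal G)$ are the sets of $y$ with $y\to x$, $x\to y$, $x-y$ respectively. A PDAG has no directed cycle; a DAG is a PDAG without undirected edges. The skeleton is obtained by forgetting directions; a v-structure is $a\to b\leftarrow c$ with $a\ne c$ not adjacent. A clique is a set of pairwise adjacent vertices (joined by edges of either kind), and it is maximal if no other clique contains it. Two DAGs are (Markov) equivalent if they have the same skeleton and the same v-structures. The CPDAG of a DAG $\mathcal G$ is the PDAG with the skeleton of $\mathcal G$ in which an edge is directed iff it occurs with this direction in all DAGs equivalent to $\mathcal G$; for a CPDAG $\mathcal G^*$, $[\mathcal G^*]$ is the set of DAGs whose CPDAG is $\mathcal G^*$. A direct causal clause (DCC) $\kappa=(\kappa_t\xrightarrow{\mathrm{or}}\kappa_h)$ over a vertex set $\mathbf V$ has a tail $\kappa_t\in\mathbf V$ and a head set $\kappa_h\subseteq\mathbf V\setminus\{\kappa_t\}$; it holds for a DAG $\mathcal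 G$ if $\kappa_h\cap ch(\kappa_t,\mathcal G)\neq\varnothing$. We write $u\to v$ for $u\xrightarrow{\mathrm{or}}\{v\}$. For a set $\mathcal K$ of DCCs, $[\mathcal G^*,\mathcal K]$ is the set of DAGs in $[\mathcal G^*]$ for which all clauses of $\mathcal K$ hold, and $\mathcal K$ is consistent with $\mathcal G^*$ if $[\mathcal G^*,\mathcal K]\ne\varnothing$. In that case the MPDAG of $[\mathcal G^*,\mathcal K]$ is the PDAG with the same skeleton and v-structures as $\mathcal G^*$ in which an edge is directed iff it occurs with this direction in all DAGs of $[\mathcal G^*,\mathcal K]$. For $\mathbf A\subseteq\mathbf V(\mathcal G^*)$ let $\mathcal G^*(\mathbf A)$ denote the undirected induced subgraph, with vertex set $\mathbf A$ and all undirected edges of $\mathcal G^*$ between vertices of $\mathbf A$. (It is itself a CPDAG.) The restriction subset of $\mathcal K$ on $\mathcal G^*(\mathbf A)$ consists of those clauses in $$\{\kappa_t\xrightarrow{\mathrm{or}}(\kappa_h\cap sib(\kappa_t,\mathcal G^*)) \mid \kappa\in\mathcal K,\ \kappa_h\cap ch(\kappa_t,\mathcal G^*)=\varnothing\}$$ whose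 tail and heads all lie in $\mathbf A$. **Theorem.** Let $\mathcal K$ be a set of DCCs over $\mathbf V(\mathcal G^*)$ consistent with a CPDAG $\mathcal G^*$, and let $\mathcal H$ be the MPDAG of $[\mathcal G^*,\mathcal K]$. For any vertex $X$ and any $\mathbf S\subseteq sib(X,\mathcal H)$, let $$\mathbf T=\{X\}\cup\big((pa(X,\mathcal H)\cup\mathbf S)\cap sib(X,\mathcal G^*)\big),$$ $$D_X=\{u\to X\mid u\in pa(X,\mathcal H)\cup\mathbf S\}\cup\{X\to v\mid v\in (sib(X,\mathcal H)\cup ch(X,\mathcal H))\setminus\mathbf S\}.$$ Then the following statements are equivalent. (i) There is a DAG $\mathcal G\in[\mathcal G^*,\mathcal K]$ with $pa(X,\mathcal G)=\mathbf S\cup pa(X,\mathcal H)$ and $ch(X,\mathcal G)=(sib(X,\mathcal H)\cup ch(X,\mathcal H))\setminus\mathbf S$. (ii) The induced subgraph of $\mathcal H$ over $\mathbf S$ is complete, and for every maximal clique $\mathbf M$ of $\mathcal G^*$ with $\mathbf T\subseteq\mathbf M$ the restriction subset of $\mathcal K\cup D_X$ on $\mathcal G^*(\mathbf M)$ is consistent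 with $\mathcal G^*(\mathbf M)$. (iii) The restriction subset of $\mathcal K\cup D_X$ on $\mathcal G^*(\{X\}\cup sib(X,\mathcal G^*))$ is consistent with $\mathcal G^*(\{X\}\cup sib(X,\mathcal G^*))$. -/

import Mathlib

/-- A partially directed graph with vertex set `verts`: between two distinct vertices there is at most
one edge, which is either directed (`dir a b` means `a → b`) or undirected (`undir a b` means
`a - b`). Undirected graphs and directed graphs without 2-cycles are special cases. -/
@[ext]
structure MixedGraph (V : Type*) where
  verts : Set V
  dir : V → V → Prop
  undir : V → V → Prop
  dir_mem : ∀ {a b : V}, dir a b → a ∈ verts ∧ b ∈ verts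
  undir_mem : ∀ {a b : V}, undir a b → a ∈ verts ∧ b ∈ verts
  dir_asymm : ∀ {a b : V}, dir a b → ¬ dir b a
  undir_symm : ∀ {a b : V}, undir a b → undir b a
  undir_irrefl : ∀ a : V, ¬ undir a a
  dir_not_undir : ∀ {a b : V}, dir a b → ¬ undir a b

namespace MixedGraph

variable {V : Type*}

/-- Two vertices are adjacent if they are joined by an edge of either kind. -/
def Adj (G : MixedGraph V) (a b : V) : Prop :=
  G.dir a b ∨ G.dir b a ∨ G.undir a b

/-- The set of parents of `x`. -/
def pa (G : MixedGraph V) (x : V) : Set V := {y | G.dir y x}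

/-- The set of children of `x`. -/
def ch (G : MixedGraph V) (x : V) : Set V := {y | G.dir x y}

/-- The set of siblings of `x`. -/
def sib (G : MixedGraph V) (x : V) : Set V := {y | G.undir x y}

/-- There is no directed cycle. -/
def IsPDAG (G : MixedGraph V) : Prop := ∀ a : V, ¬ Relation.TransGen G.dir a a

/-- A directed acyclic graph: all edges are directed and there is no directed cycle. -/
def IsDAG (G : MixedGraph V) : Prop := (∀ a b : V, ¬ G.undir a b) ∧ G.IsPDAG

/-- The triple `(a, b, c)` is a v-structure collided on `b`: `a → b ← c` with `a ≠ c` and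
`a`, `c` not adjacent. -/
def IsVStructure (G : MixedGraph V) (a b c : V) : Prop :=
  a ≠ c ∧ G.dir a b ∧ G.dir c b ∧ ¬ G.Adj a c

/-- Same vertices and same adjacencies. -/
def SameSkeleton (G G' : MixedGraph V) : Prop :=
  G.verts = G'.verts ∧ ∀ a b : V, G.Adj a b ↔ G'.Adj a b

def SameVStructures (G G' : MixedGraph V) : Prop :=
  ∀ a b c : V, G.IsVStructure a b c ↔ G'.IsVStructure a b c

/-- Markov equivalence (used for DAGs): same skeleton and same v-structures. -/
def MarkovEquiv (G G' : MixedGraph V) : Prop :=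
  G.SameSkeleton G' ∧ G.SameVStructures G'

/-- `P` is the completed PDAG of the DAG `G`: it is a PDAG with the skeleton of `G`, and an edge is
directed in `P` iff it appears with this direction in all DAGs that are equivalent to `G`. -/
def IsCPDAGOf (P G : MixedGraph V) : Prop :=
  P.IsPDAG ∧ P.SameSkeleton G ∧
    ∀ a b : V, P.dir a b ↔ ∀ G' : MixedGraph V, G'.IsDAG → G'.MarkovEquiv G → G'.dir a b

/-- `P` is a CPDAG, i.e. the completed PDAG of some DAG. -/
def IsCPDAG (P : MixedGraph V) : Prop :=
  ∃ G : MixedGraph V, G.IsDAG ∧ P.IsCPDAGOf G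

/-- The Markov equivalence class `[P]` represented by the CPDAG `P`: all DAGs whose CPDAG is `P`. -/
def markovClass (P : MixedGraph V) : Set (MixedGraph V) :=
  {G | G.IsDAG ∧ P.IsCPDAGOf G}

/-- The undirected induced subgraph over `A`: its vertices are those in `A`, its edges are the
undirected edges between them. -/
def undirInduce (G : MixedGraph V) (A : Set V) : MixedGraph V where
  verts := G.verts ∩ A
  dir := fun _ _ => False
  undir := fun a b => G.undir a b ∧ a ∈ A ∧ b ∈ A
  dir_mem := fun h => h.elim
  undir_mem := fun h => ⟨⟨(G.undir_mem h.1).1, h.2.1⟩, ⟨(G.undir_mem h.1).2, h.2.2⟩⟩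
  dir_asymm := fun h => h.elim
  undir_symm := fun h => ⟨G.undir_symm h.1, h.2.2, h.2.1⟩
  undir_irrefl := fun a h => G.undir_irrefl a h.1
  dir_not_undir := fun h => h.elim

/-- `A` is a clique: a set of pairwise adjacent vertices, so that the induced subgraph over `A` is
complete. -/
def IsClique (G : MixedGraph V) (A : Set V) : Prop :=
  A ⊆ G.verts ∧ ∀ a ∈ A, ∀ b ∈ A, a ≠ b → G.Adj a b

/-- `A` is a clique that is not properly contained in another one. -/
def IsMaximalClique (G : MixedGraph V) (A : Set V) : Prop :=
  G.IsClique A ∧ ∀ B : Set V, G.IsClique B → A ⊆ B → B = A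

end MixedGraph

/-- A direct causal clause `tail →ᵒʳ heads`: `tail` is a direct cause of at least one vertex in
`heads`, where `tail ∉ heads` and `heads` may be empty. -/
@[ext]
structure DCC (V : Type*) where
  tail : V
  heads : Set V
  tail_notMem : tail ∉ heads

namespace DCC

variable {V : Type*}

/-- All vertices that occur in the clause are in `A`. -/
def IsOver (κ : DCC V) (A : Set V) : Prop := κ.tail ∈ A ∧ κ.heads ⊆ A

/-- The clause holds for the DAG `G`. -/
def Holds (κ : DCC V) (G : MixedGraph V) : Prop := (κ.heads ∩ G.ch κ.tail).Nonempty

end DCC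

namespace MixedGraph

variable {V : Type*}

/-- The restricted Markov equivalence class `[P, K]`. -/
def restrictedClass (P : MixedGraph V) (K : Set (DCC V)) : Set (MixedGraph V) :=
  {G | G ∈ P.markovClass ∧ ∀ κ ∈ K, κ.Holds G}

/-- The clause set `K` is consistent with the CPDAG `P`. -/
def Consistent (P : MixedGraph V) (K : Set (DCC V)) : Prop :=
  (P.restrictedClass K).Nonempty

/-- `H` is the MPDAG of the class `[P, K]`: a PDAG with the skeleton and the v-structures of `P`, in
which an edge is directed iff it appears with this direction in all DAGs of the class. -/
def IsMPDAGOf (H P : MixedGraph V) (K : Set (DCC V)) : Prop :=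
  H.IsPDAG ∧ H.SameSkeleton P ∧ H.SameVStructures P ∧
    ∀ a b : V, H.dir a b ↔ ∀ G ∈ P.restrictedClass K, G.dir a b

/-- The reduced form `K(P)`: drop the clauses with a head that is a child of the tail in `P`, and
intersect the head sets of the others with the siblings of the tail in `P`. -/
def reducedForm (P : MixedGraph V) (K : Set (DCC V)) : Set (DCC V) :=
  {κ' | ∃ κ ∈ K, κ.heads ∩ P.ch κ.tail = ∅ ∧
    κ'.tail = κ.tail ∧ κ'.heads = κ.heads ∩ P.sib κ.tail}

/-- The restriction subset of `K` on an undirected induced subgraph `U` of `P`: the clauses of the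
reduced form of `K` with respect to `P` all of whose vertices are in `U`. -/
def restrictionSubset (P : MixedGraph V) (K : Set (DCC V)) (U : MixedGraph V) : Set (DCC V) :=
  {κ | κ ∈ P.reducedForm K ∧ κ.IsOver U.verts}

/-- The clauses `u → X` for `u ∈ pa(X, H) ∪ S`, and `X → v` for
`v ∈ (sib(X, H) ∪ ch(X, H)) \ S`. -/
def orientationClauses (H : MixedGraph V) (X : V) (S : Set V) : Set (DCC V) :=
  {κ | (κ.tail ∈ H.pa X ∪ S ∧ κ.heads = {X}) ∨
    (κ.tail = X ∧ ∃ v ∈ (H.sib X ∪ H.ch X) \ S, κ.heads = {v})}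

end MixedGraph

/-! The DAGs in the class of a CPDAG correspond to the acyclic, v-structure-free ("moral")
orientations of its undirected part. So (i) asks for a moral orientation satisfying the reduced
clauses of `K` and the star clauses `u → X` (`u ∈ B`), `X → v` (`v ∈ C`), where `B` and `C` are the
prescribed parents and children among the siblings of `X` in the CPDAG.

In such an orientation, the sink of any nonempty set `A` is simplicial in `A` and is not the tail of
a clause with all heads in `A`. Conversely, if every nonempty `A` has such a vertex, peeling these
vertices off one by one builds the orientation (`exists_moralOrientation`). The only obstructions
are therefore nonempty stuck sets.

The core is `exists_moralOrientation_of_cliques`: an obstruction can be traced to a clique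
containing `X` and `B`. By definition of the MPDAG, each single edge at `X` can be given its
prescribed direction by an orientation satisfying `K`. The sinks of these orientations in a stuck
set are blocked only by star clauses, so they lie in `B ∪ {X}`. After adding `B` to the set, some `u
∈ B` is simplicial, and its closed neighbourhood is a clique `M`. By
`IsMoralOrientation.dir_of_exit`, a vertex of `M` with a neighbour outside must precede every vertex
of `M` without one; this carries the obstruction over to `M`. Both (ii) and (iii) rule it out there,
because a sink of `M` in a consistent local orientation is unblocked. -/

namespace MixedGraph

/-! ### Moral orientations, elimination orders and stuck sets -/

/-- `R` is an acyclic orientation of `U` without v-structures. -/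
structure IsMoralOrientation {V : Type*} (U R : V → V → Prop) : Prop where
  sub : ∀ {a b}, R a b → U a b
  total : ∀ {a b}, U a b → R a b ∨ R b a
  acyclic : ∀ a, ¬ Relation.TransGen R a a
  moral : ∀ {a b c}, R a b → R c b → a ≠ c → U a c

/-- The neighbours of `v` in `A` are pairwise adjacent. -/
def Simplicial {V : Type*} (U : V → V → Prop) (A : Set V) (v : V) : Prop :=
  ∀ a ∈ A, ∀ b ∈ A, U a v → U b v → a ≠ b → U a b

/-- `v` is the tail of a clause all of whose heads lie in `A`. -/
def Blocked {V : Type*} (D : Set (DCC V)) (A : Set V) (v : V) : Prop :=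
  ∃ κ ∈ D, κ.tail = v ∧ κ.heads ⊆ A

/-- No vertex of `A` can be the last one in `A` of a moral orientation that satisfies `D`. -/
def Stuck {V : Type*} (U : V → V → Prop) (D : Set (DCC V)) (A : Set V) : Prop :=
  ∀ v ∈ A, Simplicial U A v → Blocked D A v

/-- The orientation `R` satisfies all clauses of `D`. -/
def Satisfies {V : Type*} (R : V → V → Prop) (D : Set (DCC V)) : Prop :=
  ∀ κ ∈ D, ∃ h ∈ κ.heads, R κ.tail h

section Orientation

variable {V : Type*} {U R : V → V → Prop} {D : Set (DCC V)}

theorem exists_sink [Finite V] (hR : ∀ a, ¬ Relation.TransGen R a a) {A : Set V}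
    (hA : A.Nonempty) : ∃ v ∈ A, ∀ w ∈ A, ¬ R v w := by
  let T : V → V → Prop := fun a b => Relation.TransGen R b a
  have : IsTrans V T := ⟨fun a b c h1 h2 => Relation.TransGen.trans h2 h1⟩
  have : Std.Irrefl T := ⟨fun a => hR a⟩
  obtain ⟨v, hv, hmin⟩ := (Finite.wellFounded_of_trans_of_irrefl T).has_min A hA
  exact ⟨v, hv, fun w hw h => hmin w hw (Relation.TransGen.single h)⟩

theorem exists_sink_reachable [Finite V] (hR : ∀ a, ¬ Relation.TransGen R a a) {A : Set V}
    {a : V} (ha : a ∈ A) :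
    ∃ v ∈ A, Relation.ReflTransGen R a v ∧ ∀ w ∈ A, ¬ R v w := by
  obtain ⟨v, ⟨hv, hav⟩, hs⟩ := exists_sink hR (A := A ∩ {v | Relation.ReflTransGen R a v})
    ⟨a, ha, Relation.ReflTransGen.refl⟩
  exact ⟨v, hv, hav, fun w hw h => hs w ⟨hw, hav.tail h⟩ h⟩

theorem IsMoralOrientation.dir_of_reach (hR : IsMoralOrientation U R) {a b : V}
    (h : Relation.ReflTransGen R a b) (hab : U a b) : R a b := by
  rcases hR.total hab with h' | h'
  · exact h'
  · exact (hR.acyclic b (Relation.TransGen.head' h' h)).elim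

theorem IsMoralOrientation.asymm (hR : IsMoralOrientation U R) {a b : V} (h : R a b) :
    ¬ R b a :=
  fun h' => hR.acyclic a ((Relation.TransGen.single h).tail h')

/-- With `Satisfies.not_blocked_of_sink`, this is the necessity half of the stuck-set criterion: a
sink is never stuck. -/
theorem IsMoralOrientation.simplicial_of_sink (hR : IsMoralOrientation U R) {A : Set V} {v : V}
    (hv : ∀ w ∈ A, ¬ R v w) : Simplicial U A v := fun a ha b hb hav hbv hab =>
  hR.moral ((hR.total hav).resolve_right (hv a ha)) ((hR.total hbv).resolve_right (hv b hb)) hab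

theorem Satisfies.not_blocked_of_sink (hR : Satisfies R D) {A : Set V} {v : V}
    (hv : ∀ w ∈ A, ¬ R v w) : ¬ Blocked D A v := by
  rintro ⟨κ, hκ, rfl, hsub⟩
  obtain ⟨h, hh, hdir⟩ := hR κ hκ
  exact hv h (hsub hh) hdir

/-- Induction on the size of `A`, making a simplicial unblocked vertex `v` the sink. Simpliciality
keeps the orientation moral. A clause inside `A` does not have tail `v`; it either has `v` as a head
and holds, or lies in `A \ {v}`. -/
theorem exists_moralOrientation_on [Finite V] (hsymm : ∀ a b, U a b → U b a)
    (hirr : ∀ a, ¬ U a a) (hD : ∀ κ ∈ D, ∀ h ∈ κ.heads, U κ.tail h)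
    (hstuck : ∀ A : Set V, A.Nonempty → ¬ Stuck U D A) (A : Set V) :
    ∃ R, IsMoralOrientation (fun a b => U a b ∧ a ∈ A ∧ b ∈ A) R ∧
      ∀ κ ∈ D, κ.tail ∈ A → κ.heads ⊆ A → ∃ h ∈ κ.heads, R κ.tail h := by
  induction hn : A.ncard generalizing A with
  | zero =>
    obtain rfl := (Set.ncard_eq_zero A.toFinite).1 hn
    refine ⟨fun _ _ => False, ⟨fun h => h.elim, fun h => h.2.1.elim, fun a h => ?_,
      fun h => h.elim⟩, fun _ _ h => h.elim⟩
    obtain ⟨_, h, -⟩ := Relation.TransGen.head'_iff.1 h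
    exact h
  | succ n ih =>
    have hne : A.Nonempty := by
      rw [← Set.ncard_pos A.toFinite]; omega
    have := hstuck A hne
    unfold Stuck at this
    push Not at this
    obtain ⟨v, hv, hsim, hblock⟩ := this
    obtain ⟨R, hR, hRD⟩ := ih (A \ {v}) (by
      rw [Set.ncard_sdiff_singleton_of_mem hv, hn]; rfl)
    have hne_of : ∀ {a b}, R a b → a ≠ v ∧ b ≠ v := fun h =>
      ⟨(hR.sub h).2.1.2, (hR.sub h).2.2.2⟩
    refine ⟨fun a b => R a b ∨ (b = v ∧ U a v ∧ a ∈ A), ⟨?_, ?_, ?_, ?_⟩, ?_⟩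
    · rintro a b (h | ⟨rfl, h, ha⟩)
      · have := hR.sub h
        exact ⟨this.1, this.2.1.1, this.2.2.1⟩
      · exact ⟨h, ha, hv⟩
    · rintro a b ⟨hab, ha, hb⟩
      by_cases hbv : b = v
      · subst hbv; exact Or.inl (Or.inr ⟨rfl, hab, ha⟩)
      by_cases hav : a = v
      · subst hav; exact Or.inr (Or.inr ⟨rfl, hsymm _ _ hab, hb⟩)
      exact (hR.total ⟨hab, ⟨ha, hav⟩, ⟨hb, hbv⟩⟩).imp Or.inl Or.inl
    · intro a h
      have hstart : ∀ {a b}, (R a b ∨ (b = v ∧ U a v ∧ a ∈ A)) → a ≠ v := by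
        rintro a b (h | ⟨rfl, h, -⟩)
        · exact (hne_of h).1
        · rintro rfl; exact hirr _ h
      have key : ∀ b, Relation.TransGen (fun a b => R a b ∨ (b = v ∧ U a v ∧ a ∈ A)) a b →
          b ≠ v → Relation.TransGen R a b := by
        intro b h
        induction h with
        | single h =>
          intro hb
          exact .single (h.resolve_right fun h => hb h.1)
        | tail _ h ih' =>
          intro hb
          exact (ih' (hstart h)).tail (h.resolve_right fun h => hb h.1)
      obtain ⟨_, hstep, -⟩ := Relation.TransGen.head'_iff.1 h
      exact hR.acyclic a (key a h (hstart hstep))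
    · rintro a b c (hab | ⟨rfl, hab, ha⟩) (hcb | ⟨hbv, hcb, hc⟩) hac
      · have := hR.moral hab hcb hac
        exact ⟨this.1, this.2.1.1, this.2.2.1⟩
      · exact ((hne_of hab).2 hbv).elim
      · exact ((hne_of hcb).2 rfl).elim
      · exact ⟨hsim a ha c hc hab hcb hac, ha, hc⟩
    · intro κ hκ htail hheads
      have htv : κ.tail ≠ v := fun h => hblock ⟨κ, hκ, h, hheads⟩
      by_cases hvh : v ∈ κ.heads
      · exact ⟨v, hvh, Or.inr ⟨rfl, hD κ hκ v hvh, htail⟩⟩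
      · obtain ⟨h, hh, hdir⟩ := hRD κ hκ ⟨htail, htv⟩
          fun h hh => ⟨hheads hh, fun e => hvh (e ▸ hh)⟩
        exact ⟨h, hh, Or.inl hdir⟩

/-- If there is no nonempty stuck set, eliminating free simplicial vertices one after the other
yields a moral orientation that satisfies all clauses. -/
theorem exists_moralOrientation [Finite V] (hsymm : ∀ a b, U a b → U b a)
    (hirr : ∀ a, ¬ U a a) (hD : ∀ κ ∈ D, ∀ h ∈ κ.heads, U κ.tail h)
    (hstuck : ∀ A : Set V, A.Nonempty → ¬ Stuck U D A) :
    ∃ R, IsMoralOrientation U R ∧ Satisfies R D := by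
  obtain ⟨R, hR, hRD⟩ := exists_moralOrientation_on hsymm hirr hD hstuck Set.univ
  refine ⟨R, ⟨fun h => (hR.sub h).1, fun h => hR.total ⟨h, trivial, trivial⟩, hR.acyclic,
    fun h h' hne => (hR.moral h h' hne).1⟩, fun κ hκ => hRD κ hκ trivial (Set.subset_univ _)⟩

/-- A set on which `U` is not complete has two nonadjacent simplicial vertices. -/
theorem IsMoralOrientation.exists_nonadjacent_simplicial [Finite V] (hR : IsMoralOrientation U R)
    (hsymm : ∀ a b, U a b → U b a) (A : Set V) :
    (∀ a ∈ A, ∀ b ∈ A, a ≠ b → U a b) ∨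
      ∃ p ∈ A, ∃ q ∈ A, p ≠ q ∧ ¬ U p q ∧ Simplicial U A p ∧ Simplicial U A q := by
  induction hn : A.ncard generalizing A with
  | zero =>
    obtain rfl := (Set.ncard_eq_zero A.toFinite).1 hn
    exact Or.inl fun a ha => ha.elim
  | succ n ih =>
    have hne : A.Nonempty := by
      rw [← Set.ncard_pos A.toFinite]; omega
    obtain ⟨v, hv, hsink⟩ := exists_sink hR.acyclic hne
    have hsim := hR.simplicial_of_sink hsink
    -- Restoring the sink `v` can spoil simpliciality only for neighbours of `v`.
    have lift : ∀ p ∈ A, ¬ U p v → Simplicial U (A \ {v}) p → Simplicial U A p := by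
      intro p _ hpv hp a ha b hb hap hbp hab
      refine hp a ⟨ha, ?_⟩ b ⟨hb, ?_⟩ hap hbp hab
      · rintro rfl; exact hpv (hsymm _ _ hap)
      · rintro rfl; exact hpv (hsymm _ _ hbp)
    rcases ih (A \ {v}) (by rw [Set.ncard_sdiff_singleton_of_mem hv, hn]; rfl) with hc |
      ⟨p, hp, q, hq, hpq, hnpq, hsp, hsq⟩
    · by_cases hall : ∀ p ∈ A, p ≠ v → U p v
      · refine Or.inl fun a ha b hb hab => ?_
        by_cases hav : a = v
        · subst hav; exact hsymm _ _ (hall b hb hab.symm)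
        by_cases hbv : b = v
        · subst hbv; exact hall a ha hab
        exact hc a ⟨ha, hav⟩ b ⟨hb, hbv⟩ hab
      · push Not at hall
        obtain ⟨p, hp, hpv, hnpv⟩ := hall
        exact Or.inr ⟨p, hp, v, hv, hpv, hnpv,
          lift p hp hnpv fun a ha b hb _ _ hab => hc a ha b hb hab, hsim⟩
    · right
      by_cases hpv : U p v
      · have hqv : ¬ U q v := fun h => hnpq (hsim p hp.1 q hq.1 hpv h hpq)
        exact ⟨q, hq.1, v, hv, hq.2, hqv, lift q hq.1 hqv hsq, hsim⟩
      · exact ⟨p, hp.1, v, hv, hp.2, hpv, lift p hp.1 hpv hsp, hsim⟩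

/-- Every edge of a morally orientable graph can be oriented in either direction. -/
theorem IsMoralOrientation.exists_orient_edge [Finite V] (hR : IsMoralOrientation U R)
    (hsymm : ∀ a b, U a b → U b a) (hirr : ∀ a, ¬ U a a) {a b : V} (hab : U a b) :
    ∃ R', IsMoralOrientation U R' ∧ R' a b := by
  have hne : a ≠ b := fun h => hirr b (h ▸ hab)
  obtain ⟨R', hR', hs⟩ := exists_moralOrientation (U := U) (D := {(⟨a, {b}, hne⟩ : DCC V)})
    hsymm hirr (by
      rintro κ rfl h hh
      obtain rfl : h = b := hh
      exact hab) (by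
      intro A hA hstuck
      -- The only clause is `a → b`, so in a stuck set `a` is the sole simplicial vertex and `b` is
      -- present.
      have huniq : ∀ v ∈ A, Simplicial U A v → a = v ∧ b ∈ A := by
        intro v hv hsv
        obtain ⟨κ, rfl, rfl, hsub⟩ := hstuck v hv hsv
        exact ⟨rfl, hsub rfl⟩
      rcases hR.exists_nonadjacent_simplicial hsymm A with hc | ⟨p, hp, q, hq, hpq, -, hsp, hsq⟩
      · have hsim : ∀ v, Simplicial U A v := fun v x hx y hy _ _ hxy => hc x hx y hy hxy
        obtain ⟨v, hv⟩ := hA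
        exact hne (huniq b (huniq v hv (hsim v)).2 (hsim b)).1
      · exact hpq ((huniq p hp hsp).1.symm.trans (huniq q hq hsq).1))
  obtain ⟨h, hh, hdir⟩ := hs _ rfl
  obtain rfl : h = b := hh
  exact ⟨R', hR', hdir⟩

end Orientation

end MixedGraph

/-! ### Compelled edges of a DAG and Meek's rules -/

namespace MixedGraph

section Compelled

variable {V : Type*} {G G' P : MixedGraph V}

theorem Adj.symm {a b : V} (h : G.Adj a b) : G.Adj b a := by
  rcases h with h | h | h
  · exact Or.inr (Or.inl h)
  · exact Or.inl h
  · exact Or.inr (Or.inr (G.undir_symm h))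

theorem IsPDAG.irrefl (h : G.IsPDAG) (a : V) : ¬ G.dir a a :=
  fun h' => h a (Relation.TransGen.single h')

theorem IsDAG.dir_or_dir (h : G.IsDAG) {a b : V} (hab : G.Adj a b) : G.dir a b ∨ G.dir b a := by
  rcases hab with h' | h' | h'
  · exact Or.inl h'
  · exact Or.inr h'
  · exact (h.1 _ _ h').elim

theorem IsDAG.dir_of_dir_dir (h : G.IsDAG) {a b c : V} (hab : G.dir a b) (hbc : G.dir b c)
    (hac : G.Adj a c) : G.dir a c :=
  (h.dir_or_dir hac).resolve_right fun hca =>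
    h.2 a (((Relation.TransGen.single hab).tail hbc).tail hca)

theorem IsVStructure.symm {a b c : V} (h : G.IsVStructure a b c) : G.IsVStructure c b a :=
  ⟨h.1.symm, h.2.2.1, h.2.1, fun h' => h.2.2.2 h'.symm⟩

theorem adj_irrefl (hG : G.IsPDAG) (a : V) : ¬ G.Adj a a := by
  rintro (h | h | h)
  · exact hG.irrefl a h
  · exact hG.irrefl a h
  · exact G.undir_irrefl a h

/-- The edges of a DAG whose direction follows from its v-structures by Meek's rules. -/
inductive Forced (G : MixedGraph V) : V → V → Prop
  | vstructure {a b c : V} : G.IsVStructure a b c → Forced G a b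
  | away {d a b : V} : Forced G d a → G.Adj a b → ¬ G.Adj d b → d ≠ b →
      ¬ G.IsVStructure d a b → Forced G a b
  | trans {a d b : V} : Forced G a d → Forced G d b → G.Adj a b → Forced G a b
  | kite {a b d e : V} : Forced G d b → Forced G e b → d ≠ e → ¬ G.Adj d e → G.Adj a d →
      G.Adj a e → G.Adj a b → ¬ G.IsVStructure d a e → Forced G a b

/-- Reversing the edge at a rule would create a directed cycle or a v-structure that `G` does not
have. -/
theorem Forced.sound (hG' : G'.IsDAG) (he : G'.MarkovEquiv G) {a b : V}
    (h : G.Forced a b) : G'.dir a b := by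
  have adj : ∀ {x y}, G.Adj x y → G'.Adj x y := fun h => (he.1.2 _ _).2 h
  induction h with
  | vstructure h => exact ((he.2 _ _ _).2 h).2.1
  | away _ hab hdb hne hv ih =>
    refine (hG'.dir_or_dir (adj hab)).resolve_right fun hba => hv ((he.2 _ _ _).1 ?_)
    exact ⟨hne, ih, hba, fun h => hdb ((he.1.2 _ _).1 h)⟩
  | trans _ _ hab ih1 ih2 => exact hG'.dir_of_dir_dir ih1 ih2 (adj hab)
  | kite _ _ hne hde had hae hab hv ih1 ih2 =>
    refine (hG'.dir_or_dir (adj hab)).resolve_right fun hba => hv ((he.2 _ _ _).1 ?_)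
    exact ⟨hne, hG'.dir_of_dir_dir ih1 hba (adj had.symm),
      hG'.dir_of_dir_dir ih2 hba (adj hae.symm), fun h => hde ((he.1.2 _ _).1 h)⟩

theorem MarkovEquiv.refl (G : MixedGraph V) : G.MarkovEquiv G :=
  ⟨⟨rfl, fun _ _ => Iff.rfl⟩, fun _ _ _ => Iff.rfl⟩

theorem MarkovEquiv.symm (h : G.MarkovEquiv G') : G'.MarkovEquiv G :=
  ⟨⟨h.1.1.symm, fun _ _ => (h.1.2 _ _).symm⟩, fun _ _ _ => (h.2 _ _ _).symm⟩

theorem MarkovEquiv.trans {G'' : MixedGraph V} (h : G.MarkovEquiv G') (h' : G'.MarkovEquiv G'') :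
    G.MarkovEquiv G'' :=
  ⟨⟨h.1.1.trans h'.1.1, fun _ _ => (h.1.2 _ _).trans (h'.1.2 _ _)⟩,
    fun _ _ _ => (h.2 _ _ _).trans (h'.2 _ _ _)⟩

theorem Forced.dir (hG : G.IsDAG) {a b : V} (h : G.Forced a b) : G.dir a b :=
  h.sound hG (MarkovEquiv.refl G)

/-- A forced edge into `b` is followed by one into every vertex joined to `b` by an unforced
edge. -/
theorem Forced.extend {a b : V} (h : G.Forced a b) :
    ∀ c, G.Adj b c → ¬ G.Forced b c → ¬ G.Forced c b → G.Forced a c := by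
  have adjacent : ∀ {a b c}, G.Forced a b → G.Adj b c → ¬ G.Forced b c → ¬ G.Forced c b →
      G.Adj a c := by
    intro a b c hab hbc hn hn'
    by_contra hac
    have hne : a ≠ c := by rintro rfl; exact hn' hab
    exact hn (.away hab hbc hac hne fun hv => hn' (.vstructure hv.symm))
  induction h with
  | @vstructure a b d hv =>
    intro c hbc hn hn'
    have hab : G.Forced a b := .vstructure hv
    have hdb : G.Forced d b := .vstructure hv.symm
    have hac := adjacent hab hbc hn hn'
    have hdc := adjacent hdb hbc hn hn'
    by_contra hFac
    -- Either `a → c ← d` is itself a v-structure, or the kite rule forces `c → b`.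
    by_cases hvc : G.IsVStructure a c d
    · exact hFac (.vstructure hvc)
    exact hn' (.kite hab hdb hv.1 hv.2.2.2 hac.symm hdc.symm hbc.symm hvc)
  | @away d a b hda hab hdb hne hv ih =>
    intro c hbc hn hn'
    have hFab : G.Forced a b := .away hda hab hdb hne hv
    have hac := adjacent hFab hbc hn hn'
    by_contra hFac
    -- Were `a`, `c` joined by an unforced edge, induction would give `d → c`, and then `b`, not
    -- adjacent to `d`, would have its edge to `c` forced.
    by_cases hFca : G.Forced c a
    · exact hn' (.trans hFca hFab hbc.symm)
    have hdc := ih c hac hFac hFca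
    exact hn' (.away hdc hbc.symm hdb hne fun h => hn (.vstructure h.symm))
  | @trans a d b had hdb hab ih1 ih2 =>
    intro c hbc hn hn'
    have hac := adjacent (.trans had hdb hab) hbc hn hn'
    exact .trans had (ih2 c hbc hn hn') hac
  | @kite a b d e hdb heb hne hde had hae hab hv ih1 ih2 =>
    intro c hbc hn hn'
    have hac := adjacent (.kite hdb heb hne hde had hae hab hv) hbc hn hn'
    exact .kite (ih1 c hbc hn hn') (ih2 c hbc hn hn') hne hde had hae hac hv

theorem Adj.mem {a b : V} (h : G.Adj a b) : a ∈ G.verts ∧ b ∈ G.verts := by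
  rcases h with h | h | h
  · exact G.dir_mem h
  · exact (G.dir_mem h).symm
  · exact G.undir_mem h

theorem exists_orientation (G : MixedGraph V) {E : V → V → Prop} (hE : ∀ a b, E a b → G.Adj a b)
    (hasymm : ∀ a b, E a b → ¬ E b a) (htotal : ∀ a b, G.Adj a b → E a b ∨ E b a) :
    ∃ G' : MixedGraph V, (∀ a b, G'.dir a b ↔ E a b) ∧ (∀ a b, ¬ G'.undir a b) ∧
      G'.SameSkeleton G := by
  refine ⟨{ verts := G.verts
            dir := E
            undir := fun _ _ => False
            dir_mem := fun h => (hE _ _ h).mem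
            undir_mem := fun h => h.elim
            dir_asymm := hasymm _ _
            undir_symm := id
            undir_irrefl := fun _ h => h
            dir_not_undir := fun _ h => h }, fun _ _ => Iff.rfl, fun _ _ h => h, rfl, ?_⟩
  refine fun a b => ⟨?_, fun h => ?_⟩
  · rintro (h | h | h)
    · exact hE _ _ h
    · exact (hE _ _ h).symm
    · exact h.elim
  · exact (htotal a b h).imp id Or.inl

/-- The edges of `G` not oriented by `F`. -/
def Rest (G : MixedGraph V) (F : V → V → Prop) (a b : V) : Prop :=
  G.Adj a b ∧ ¬ F a b ∧ ¬ F b a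

/-- Partial orientations `F` of the DAG `G` that contain its v-structures and are such that the
remaining edges can be oriented independently of `F`. -/
structure IsCore (G : MixedGraph V) (F : V → V → Prop) : Prop where
  dir : ∀ {a b}, F a b → G.dir a b
  vstructure : ∀ {a b c}, G.IsVStructure a b c → F a b
  extend : ∀ {a b c}, F a b → G.Rest F b c → F a c

theorem isCore_forced (hG : G.IsDAG) : G.IsCore G.Forced :=
  ⟨fun h => h.dir hG, .vstructure, fun h h' => h.extend _ h'.1 h'.2.1 h'.2.2⟩

theorem Rest.symm {F : V → V → Prop} {a b : V} (h : G.Rest F a b) : G.Rest F b a :=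
  ⟨h.1.symm, h.2.2, h.2.1⟩

/-- A DAG equivalent to `G` induces a moral orientation of the edges outside a core. -/
theorem IsCore.isMoralOrientation {F : V → V → Prop} (hF : G.IsCore F) (hG' : G'.IsDAG)
    (he : G'.MarkovEquiv G) :
    IsMoralOrientation (G.Rest F) (fun a b => G'.dir a b ∧ G.Rest F a b) where
  sub h := h.2
  total {a b} h := (hG'.dir_or_dir ((he.1.2 _ _).2 h.1)).imp (fun h' => ⟨h', h⟩)
    (fun h' => ⟨h', h.symm⟩)
  acyclic a h := hG'.2 a (h.lift id fun _ _ h => h.1)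
  moral {a b c} h h' hne := by
    have hac : G.Adj a c := by
      by_contra hac
      exact h.2.2.1 (hF.vstructure ((he.2 _ _ _).1
        ⟨hne, h.1, h'.1, fun h => hac ((he.1.2 _ _).1 h)⟩))
    refine ⟨hac, fun hF' => h.2.2.1 (hF.extend hF' h'.2),
      fun hF' => h'.2.2.1 (hF.extend hF' h.2)⟩

/-- Conversely, every moral orientation of these edges comes from a DAG equivalent to `G`. -/
theorem IsCore.exists_markovEquiv {F R : V → V → Prop} (hG : G.IsDAG) (hF : G.IsCore F)
    (hR : IsMoralOrientation (G.Rest F) R) :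
    ∃ G' : MixedGraph V, G'.IsDAG ∧ G'.MarkovEquiv G ∧ ∀ a b, G'.dir a b ↔ F a b ∨ R a b := by
  have hFasymm : ∀ {a b}, F a b → ¬ F b a := fun h h' => G.dir_asymm (hF.dir h) (hF.dir h')
  obtain ⟨G', hdir, hundir, hskel⟩ := exists_orientation G (E := fun a b => F a b ∨ R a b)
    (fun a b h => h.elim (fun h => Or.inl (hF.dir h)) fun h => (hR.sub h).1)
    (by
      rintro a b (h | h) (h' | h')
      · exact hFasymm h h'
      · exact (hR.sub h').2.2 h
      · exact (hR.sub h).2.2 h'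
      · exact hR.asymm h h')
    (by
      intro a b h
      by_cases h1 : F a b
      · exact Or.inl (Or.inl h1)
      by_cases h2 : F b a
      · exact Or.inr (Or.inl h2)
      exact (hR.total ⟨h, h1, h2⟩).imp Or.inr Or.inr)
  refine ⟨G', ⟨hundir, ?_⟩, ⟨hskel, ?_⟩, hdir⟩
  -- An `F` edge absorbs the `R` steps after it, by `IsCore.extend`. Hence a cycle using some `F`
  -- edge shrinks to a cycle of `F` edges, impossible in `G`.
  · have reach : ∀ {a b}, F a b → ∀ c, Relation.ReflTransGen (fun a b => F a b ∨ R a b) b c →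
        ∃ e, Relation.ReflTransGen F a e ∧ F e c := by
      intro a b hab c hbc
      induction hbc with
      | refl => exact ⟨a, .refl, hab⟩
      | tail _ h ih =>
        obtain ⟨e, hae, hec⟩ := ih
        rcases h with h | h
        · exact ⟨_, hae.tail hec, h⟩
        · exact ⟨e, hae, hF.extend hec (hR.sub h)⟩
    have split : ∀ {a c}, Relation.TransGen (fun a b => F a b ∨ R a b) a c →
        Relation.TransGen R a c ∨ ∃ p q, Relation.ReflTransGen (fun a b => F a b ∨ R a b) a p ∧
          F p q ∧ Relation.ReflTransGen (fun a b => F a b ∨ R a b) q c := by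
      intro a c h
      induction h with
      | single h => exact h.elim (fun h => Or.inr ⟨_, _, .refl, h, .refl⟩) fun h => Or.inl (.single h)
      | tail hab h ih =>
        rcases ih with ih | ⟨p, q, hp, hpq, hq⟩
        · exact h.elim (fun h => Or.inr ⟨_, _, hab.to_reflTransGen, h, .refl⟩)
            fun h => Or.inl (ih.tail h)
        · exact Or.inr ⟨p, q, hp, hpq, hq.tail h⟩
    intro a h
    rcases split (h.lift id fun a b => (hdir a b).1) with h | ⟨p, q, hp, hpq, hq⟩
    · exact hR.acyclic a h
    · obtain ⟨e, hpe, hep⟩ := reach hpq p (hq.trans hp)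
      exact hG.2 p ((Relation.TransGen.tail' hpe hep).lift id fun _ _ h => hF.dir h)
  · rintro a b c
    refine ⟨fun ⟨hne, hab, hcb, hac⟩ => ?_, fun h => ?_⟩
    · have hac' : ¬ G.Adj a c := fun h => hac ((hskel.2 a c).2 h)
      rcases (hdir a b).1 hab with h | h <;> rcases (hdir c b).1 hcb with h' | h'
      · exact ⟨hne, hF.dir h, hF.dir h', hac'⟩
      · exact (hac' (Or.inl (hF.dir (hF.extend h (hR.sub h').symm)))).elim
      · exact (hac' (Or.inr (Or.inl (hF.dir (hF.extend h' (hR.sub h).symm))))).elim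
      · exact (hac' (hR.moral h h' hne).1).elim
    · exact ⟨h.1, (hdir a b).2 (Or.inl (hF.vstructure h)),
        (hdir c b).2 (Or.inl (hF.vstructure h.symm)), fun h' => h.2.2.2 ((hskel.2 a c).1 h')⟩

/-- Completeness of the rules: the unforced edges carry a moral orientation, so any one of them can
be reversed, and gluing with the forced edges gives an equivalent DAG. -/
theorem IsCPDAGOf.dir_iff_forced [Finite V] (hG : G.IsDAG) (hP : P.IsCPDAGOf G) {a b : V} :
    P.dir a b ↔ G.Forced a b := by
  refine ⟨fun h => ?_, fun h => (hP.2.2 a b).2 fun G' hG' he => h.sound hG' he⟩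
  by_contra hn
  have h := (hP.2.2 a b).1 h
  have hab := h G hG (MarkovEquiv.refl G)
  have hn' : ¬ G.Forced b a := fun h' => G.dir_asymm hab (h'.dir hG)
  have hF := isCore_forced hG
  obtain ⟨R, hR, hba⟩ := (hF.isMoralOrientation hG (MarkovEquiv.refl G)).exists_orient_edge
    (fun _ _ => Rest.symm) (fun a h => adj_irrefl hG.2 a h.1)
    (show G.Rest G.Forced b a from ⟨Or.inr (Or.inl hab), hn', hn⟩)
  obtain ⟨G', hG', he, hdir⟩ := hF.exists_markovEquiv hG hR
  exact G'.dir_asymm (h G' hG' he) ((hdir b a).2 (Or.inr hba))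

theorem IsCPDAGOf.isCore [Finite V] (hG : G.IsDAG) (hP : P.IsCPDAGOf G) : G.IsCore P.dir := by
  have : P.dir = G.Forced := by
    funext a b
    exact propext (hP.dir_iff_forced hG)
  rw [this]
  exact isCore_forced hG

theorem IsCPDAGOf.rest_iff (hP : P.IsCPDAGOf G) {a b : V} : G.Rest P.dir a b ↔ P.undir a b := by
  constructor
  · rintro ⟨h, h1, h2⟩
    exact (((hP.2.1.2 a b).2 h).resolve_left h1).resolve_left h2
  · intro h
    exact ⟨(hP.2.1.2 a b).1 (Or.inr (Or.inr h)), fun h' => P.dir_not_undir h' h,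
      fun h' => P.dir_not_undir h' (P.undir_symm h)⟩

end Compelled

/-! ### Markov classes as moral orientations of the undirected part -/

section MarkovClass

variable {V : Type*} {G G' P H : MixedGraph V} {K : Set (DCC V)}

theorem mem_markovClass_of_markovEquiv (hG : G ∈ P.markovClass) (hG' : G'.IsDAG)
    (he : G'.MarkovEquiv G) : G' ∈ P.markovClass := by
  refine ⟨hG', hG.2.1, ⟨hG.2.2.1.1.trans he.1.1.symm, fun a b =>
    (hG.2.2.1.2 a b).trans (he.1.2 a b).symm⟩, fun a b => (hG.2.2.2 a b).trans ?_⟩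
  exact ⟨fun h G'' hd h' => h G'' hd (h'.trans he), fun h G'' hd h' => h G'' hd (h'.trans he.symm)⟩

theorem dir_of_mem_markovClass (hG : G ∈ P.markovClass) {a b : V} (h : P.dir a b) : G.dir a b :=
  (hG.2.2.2 a b).1 h G hG.1 (MarkovEquiv.refl G)

theorem adj_iff_of_mem_markovClass (hG : G ∈ P.markovClass) {a b : V} : P.Adj a b ↔ G.Adj a b :=
  hG.2.2.1.2 a b

theorem exists_mem_markovClass_dir (hG : G ∈ P.markovClass) {a b : V} (h : P.undir a b) :
    ∃ G' ∈ P.markovClass, G'.dir a b := by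
  have hn : ¬ P.dir b a := fun h' => P.dir_not_undir h' (P.undir_symm h)
  rw [hG.2.2.2 b a] at hn
  push Not at hn
  obtain ⟨G', hG', he, hn⟩ := hn
  have hG'P := mem_markovClass_of_markovEquiv hG hG' he
  exact ⟨G', hG'P, (hG'.dir_or_dir ((adj_iff_of_mem_markovClass hG'P).1
    (Or.inr (Or.inr h)))).resolve_right hn⟩

theorem isMoralOrientation_of_mem_markovClass [Finite V] (hG : G ∈ P.markovClass) :
    IsMoralOrientation P.undir (fun a b => G.dir a b ∧ P.undir a b) := by
  have h := (hG.2.isCore hG.1).isMoralOrientation hG.1 (MarkovEquiv.refl G)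
  have he : G.Rest P.dir = P.undir := by
    funext a b
    exact propext hG.2.rest_iff
  rwa [he] at h

theorem exists_mem_markovClass_of_isMoralOrientation [Finite V] (hG : G ∈ P.markovClass)
    {R : V → V → Prop} (hR : IsMoralOrientation P.undir R) :
    ∃ G' ∈ P.markovClass, ∀ a b, G'.dir a b ↔ P.dir a b ∨ R a b := by
  have he : P.undir = G.Rest P.dir := by
    funext a b
    exact propext hG.2.rest_iff.symm
  rw [he] at hR
  obtain ⟨G', hG', he, hdir⟩ := (hG.2.isCore hG.1).exists_markovEquiv hG.1 hR
  exact ⟨G', mem_markovClass_of_markovEquiv hG hG' he, hdir⟩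

/-- Adjacent siblings of a vertex are siblings. -/
theorem undir_of_adj_of_undir [Finite V] (hG : G ∈ P.markovClass) {a b c : V} (hab : P.undir a b)
    (hcb : P.undir c b) (hac : P.Adj a c) : P.undir a c := by
  have hF := hG.2.isCore hG.1
  rcases hac with h | h | h
  · exact (P.dir_not_undir (hF.extend h (hG.2.rest_iff.2 hcb)) hab).elim
  · exact (P.dir_not_undir (hF.extend h (hG.2.rest_iff.2 hab)) hcb).elim
  · exact h

/-- Restrictions of class members to `A` have no v-structures, so they are all equivalent. Each
undirected edge occurs in both directions among them, so none is compelled. -/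
theorem exists_mem_markovClass_undirInduce [Finite V] (hG : G ∈ P.markovClass) (A : Set V) :
    ∃ O ∈ (P.undirInduce A).markovClass,
      ∀ a b, O.dir a b ↔ G.dir a b ∧ P.undir a b ∧ a ∈ A ∧ b ∈ A := by
  have key : ∀ G ∈ P.markovClass, ∃ O : MixedGraph V, O.IsDAG ∧
      O.SameSkeleton (P.undirInduce A) ∧ (∀ a b c, ¬ O.IsVStructure a b c) ∧
      ∀ a b, O.dir a b ↔ G.dir a b ∧ P.undir a b ∧ a ∈ A ∧ b ∈ A := by
    intro G hG
    have hR := isMoralOrientation_of_mem_markovClass hG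
    obtain ⟨O, hdir, hundir, hskel⟩ := exists_orientation (P.undirInduce A)
      (E := fun a b => G.dir a b ∧ P.undir a b ∧ a ∈ A ∧ b ∈ A)
      (fun a b h => Or.inr (Or.inr h.2)) (fun a b h h' => G.dir_asymm h.1 h'.1) (by
        rintro a b (h | h | h)
        · exact h.elim
        · exact h.elim
        · exact (hR.total h.1).imp (fun h' => ⟨h'.1, h⟩)
            fun h' => ⟨h'.1, P.undir_symm h.1, h.2.2, h.2.1⟩)
    refine ⟨O, ⟨hundir, fun a h => hG.1.2 a (h.lift id fun a b h => ((hdir a b).1 h).1)⟩, hskel, ?_,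
      hdir⟩
    rintro a b c ⟨hne, hab, hcb, hac⟩
    have hab := (hdir a b).1 hab
    have hcb := (hdir c b).1 hcb
    exact hac ((hskel.2 a c).2 (Or.inr (Or.inr
      ⟨hR.moral ⟨hab.1, hab.2.1⟩ ⟨hcb.1, hcb.2.1⟩ hne, hab.2.2.1, hcb.2.2.1⟩)))
  obtain ⟨O, hO, hskel, hv, hdir⟩ := key G hG
  refine ⟨O, ⟨hO, fun a h => ?_, ⟨hskel.1.symm, fun a b => (hskel.2 a b).symm⟩, fun a b =>
    ⟨fun h => h.elim, fun h => ?_⟩⟩, hdir⟩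
  · obtain ⟨_, h, -⟩ := Relation.TransGen.head'_iff.1 h
    exact h
  · have hab := (hdir a b).1 (h O hO (MarkovEquiv.refl O))
    obtain ⟨G', hG', hba⟩ := exists_mem_markovClass_dir hG (P.undir_symm hab.2.1)
    obtain ⟨O', hO', hskel', hv', hdir'⟩ := key G' hG'
    exact G'.dir_asymm hba ((hdir' a b).1 (h O' hO' ⟨⟨hskel'.1.trans hskel.1.symm, fun a b =>
      (hskel'.2 a b).trans (hskel.2 a b).symm⟩, fun a b c =>
      ⟨fun h => (hv' a b c h).elim, fun h => (hv a b c h).elim⟩⟩)).1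

theorem holds_reducedForm (hG : G ∈ P.restrictedClass K) :
    Satisfies (fun a b => G.dir a b ∧ P.undir a b) (P.reducedForm K) := by
  rintro κ' ⟨κ, hκ, hch, htail, hheads⟩
  obtain ⟨h, hh, hdir⟩ := hG.2 κ hκ
  have hdir : G.dir κ.tail h := hdir
  have hund : P.undir κ.tail h := by
    rcases (adj_iff_of_mem_markovClass hG.1).2 (Or.inl hdir) with h' | h' | h'
    · exact (Set.eq_empty_iff_forall_notMem.1 hch h ⟨hh, h'⟩).elim
    · exact (G.dir_asymm hdir (dir_of_mem_markovClass hG.1 h')).elim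
    · exact h'
  rw [htail, hheads]
  exact ⟨h, ⟨hh, hund⟩, hdir, hund⟩

theorem consistent_undirInduce [Finite V] (hG : G ∈ P.restrictedClass K) (A : Set V) :
    (P.undirInduce A).Consistent (P.restrictionSubset K (P.undirInduce A)) := by
  obtain ⟨O, hO, hdir⟩ := exists_mem_markovClass_undirInduce hG.1 A
  refine ⟨O, hO, fun κ hκ => ?_⟩
  obtain ⟨h, hh, hd⟩ := holds_reducedForm hG κ hκ.1
  exact ⟨h, hh, (hdir _ _).2 ⟨hd.1, hd.2, hκ.2.1.2, (hκ.2.2 hh).2⟩⟩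

/-- A sink of `M` in a local DAG works. As `M` may be smaller than `A`, consistency on a maximal
clique or on the neighbourhood of `X` serves for every clique inside it. -/
theorem exists_not_blocked_of_consistent [Finite V] {A M : Set V}
    (h : (P.undirInduce A).Consistent (P.restrictionSubset K (P.undirInduce A)))
    (hM : M ⊆ P.verts ∩ A) (hne : M.Nonempty) :
    ∃ w ∈ M, ¬ Blocked (P.reducedForm K) M w := by
  obtain ⟨O, hO, hOK⟩ := h
  obtain ⟨w, hw, hsink⟩ := exists_sink hO.1.2 hne
  refine ⟨w, hw, ?_⟩
  rintro ⟨κ, hκ, rfl, hsub⟩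
  obtain ⟨h, hh, hdir⟩ := hOK κ ⟨hκ, hM hw, hsub.trans hM⟩
  exact hsink h (hsub hh) hdir

end MarkovClass
end MixedGraph

/-! ### From cliques to the whole graph -/

namespace MixedGraph

section Cliques

variable {V : Type*}

/-- The clauses that orient the edges at `X`: `u → X` for `u ∈ B` and `X → v` for `v ∈ C`. -/
def starClauses (X : V) (B C : Set V) : Set (DCC V) :=
  {κ | (κ.tail ∈ B ∧ κ.heads = {X}) ∨ (κ.tail = X ∧ ∃ v ∈ C, κ.heads = {v})}

/-- The last vertices of `A` in an orientation that satisfies `K` are simplicial and not blocked.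
If all such vertices lie in a clique `M` that contains the neighbours of its simplicial vertices,
then every vertex of `M` with a neighbour in `A \ M` points to all simplicial vertices in `M`. -/
theorem IsMoralOrientation.dir_of_exit [Finite V] {U R : V → V → Prop} {K : Set (DCC V)}
    (hR : IsMoralOrientation U R) (hRK : Satisfies R K) (hsymm : ∀ a b, U a b → U b a)
    {A M : Set V} (hleaf : ∀ v ∈ A, Simplicial U A v → ¬ Blocked K A v → v ∈ M)
    (hMU : ∀ a ∈ M, ∀ b ∈ M, a ≠ b → U a b)
    {z y v : V} (hz : z ∈ M) (hy : y ∈ A) (hyM : y ∉ M) (hzy : U z y) (hv : v ∈ M)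
    (hnbr : ∀ y ∈ A, U y v → y ∈ M) : R z v := by
  have hzv : z ≠ v := by
    rintro rfl
    exact hyM (hnbr y hy (hsymm _ _ hzy))
  refine (hR.total (hMU z hz v hv hzv)).resolve_right fun hvz => ?_
  -- Otherwise `y` and `v` are both parents of `z`, so `y` is a neighbour of `v` outside `M`.
  have hRzy : R z y := (hR.total hzy).resolve_right fun h =>
    hyM (hnbr y hy (hR.moral h hvz (by rintro rfl; exact hyM hv)))
  -- A last vertex outside `M` reachable from `z` is no sink of `A`, so it steps back into `M`. That
  -- yields a cycle through `v` or a neighbour of `v` outside `M`.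
  obtain ⟨y', ⟨hy'A, hy'M, hzy'⟩, hsink⟩ := exists_sink hR.acyclic
    (A := {y | y ∈ A ∧ y ∉ M ∧ Relation.TransGen R z y}) ⟨y, hy, hyM, .single hRzy⟩
  obtain ⟨z', hz', hyz'⟩ : ∃ z' ∈ A, R y' z' := by
    by_contra! hs
    exact hy'M (hleaf y' hy'A (hR.simplicial_of_sink hs) (hRK.not_blocked_of_sink hs))
  have hz'M : z' ∈ M := by
    by_contra hn
    exact hsink z' ⟨hz', hn, hzy'.tail hyz'⟩ hyz'
  have hz'v : z' ≠ v := by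
    rintro rfl
    exact hy'M (hnbr y' hy'A (hR.sub hyz'))
  rcases hR.total (hMU z' hz'M v hv hz'v) with h | h
  · exact hR.acyclic z (((hzy'.tail hyz').tail h).tail hvz)
  · exact hy'M (hnbr y' hy'A (hR.moral hyz' h (by rintro rfl; exact hy'M hv)))

/-- If each edge at `X` can be given its prescribed direction and the prescribed directions can be
realized on every clique that contains `X` and its prescribed parents `B`, then they can all be
realized at once. -/
theorem exists_moralOrientation_of_cliques [Finite V] {U : V → V → Prop}
    (hsymm : ∀ a b, U a b → U b a) (hirr : ∀ a, ¬ U a a) {K : Set (DCC V)}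
    (hK : ∀ κ ∈ K, ∀ h ∈ κ.heads, U κ.tail h) {X : V} {B C : Set V}
    (hBC : ∀ v, U X v ↔ v ∈ B ∨ v ∈ C)
    (hne : ∃ R, IsMoralOrientation U R ∧ Satisfies R K)
    (hB : ∀ u ∈ B, ∃ R, IsMoralOrientation U R ∧ Satisfies R K ∧ R u X)
    (hC : ∀ v ∈ C, ∃ R, IsMoralOrientation U R ∧ Satisfies R K ∧ R X v)
    (hBU : ∀ a ∈ B, ∀ b ∈ B, a ≠ b → U a b)
    (hcl : ∀ M : Set V, X ∈ M → B ⊆ M → (∀ a ∈ M, ∀ b ∈ M, a ≠ b → U a b) →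
      ∃ w ∈ M, ¬ Blocked (K ∪ starClauses X B C) M w) :
    ∃ R, IsMoralOrientation U R ∧ Satisfies R (K ∪ starClauses X B C) := by
  have hUB : ∀ u ∈ B, U X u := fun u hu => (hBC u).2 (Or.inl hu)
  have hUC : ∀ u ∈ C, U X u := fun u hu => (hBC u).2 (Or.inr hu)
  have blockB : ∀ {A : Set V} {u}, u ∈ B → X ∈ A → Blocked (K ∪ starClauses X B C) A u := by
    intro A u hu hXA
    refine ⟨⟨u, {X}, fun h => ?_⟩, Or.inr (Or.inl ⟨hu, rfl⟩), rfl,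
      Set.singleton_subset_iff.2 hXA⟩
    obtain rfl : u = X := h
    exact hirr _ (hUB _ hu)
  have blockC : ∀ {A : Set V} {v}, v ∈ C → v ∈ A → Blocked (K ∪ starClauses X B C) A X := by
    intro A v hv hvA
    refine ⟨⟨X, {v}, fun h => ?_⟩, Or.inr (Or.inr ⟨rfl, v, hv, rfl⟩), rfl,
      Set.singleton_subset_iff.2 hvA⟩
    obtain rfl : X = v := h
    exact hirr _ (hUC _ hv)
  have starBlock : ∀ {A : Set V} {v}, v ∈ A → Blocked (K ∪ starClauses X B C) A v →
      ¬ Blocked K A v → X ∈ A ∧ (v ∈ B ∨ v = X ∧ ∃ c ∈ C, c ∈ A) := by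
    rintro A v hv ⟨κ, hκ | ⟨hB, hX⟩ | ⟨hX, c, hc, hcκ⟩, rfl, hsub⟩ hn
    · exact (hn ⟨κ, hκ, rfl, hsub⟩).elim
    · exact ⟨hsub (by rw [hX]; rfl), Or.inl hB⟩
    · exact ⟨hX ▸ hv, Or.inr ⟨hX, c, hc, hsub (by rw [hcκ]; rfl)⟩⟩
  refine exists_moralOrientation hsymm hirr ?_ fun A₀ hA₀ hstuck₀ => ?_
  · rintro κ (hκ | ⟨hκ, hX⟩ | ⟨hX, c, hc, hcκ⟩) h hh
    · exact hK κ hκ h hh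
    · rw [hX] at hh
      obtain rfl : h = X := hh
      exact hsymm _ _ (hUB _ hκ)
    · rw [hcκ] at hh
      obtain rfl : h = c := hh
      exact hX ▸ hUC _ hc
  obtain ⟨R₀, hR₀, hR₀K⟩ := hne
  have hX₀ : X ∈ A₀ := by
    obtain ⟨v, hv, hs⟩ := exists_sink hR₀.acyclic hA₀
    exact (starBlock hv (hstuck₀ v hv (hR₀.simplicial_of_sink hs))
      (hR₀K.not_blocked_of_sink hs)).1
  -- Adding all prescribed parents keeps the set stuck.
  obtain ⟨A, hXA, hBA, hstuck⟩ : ∃ A : Set V, X ∈ A ∧ B ⊆ A ∧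
      Stuck U (K ∪ starClauses X B C) A := by
    refine ⟨A₀ ∪ B, Or.inl hX₀, Set.subset_union_right, ?_⟩
    rintro v (hv | hv) hs
    · obtain ⟨κ, hκ, htail, hsub⟩ := hstuck₀ v hv fun a ha b hb => hs a (Or.inl ha) b (Or.inl hb)
      exact ⟨κ, hκ, htail, hsub.trans Set.subset_union_left⟩
    · exact blockB hv (Or.inl hX₀)
  have hleaf : ∀ v ∈ A, Simplicial U A v → ¬ Blocked K A v → v ∈ B ∨ v = X ∧ ∃ c ∈ C, c ∈ A :=
    fun v hv hs hn => (starBlock hv (hstuck v hv hs) hn).2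
  by_cases hL : ∃ u ∈ B, Simplicial U A u
  swap
  · push Not at hL
    -- With no simplicial vertex in `B`, every admissible orientation has `X` as its only sink in
    -- `A`. Then `c` reaches `X` even when `X → c` is imposed.
    have hlast : ∀ R, IsMoralOrientation U R → Satisfies R K → ∀ v ∈ A, (∀ w ∈ A, ¬ R v w) →
        v = X ∧ ∃ c ∈ C, c ∈ A := fun R hR hRK v hv hs =>
      (hleaf v hv (hR.simplicial_of_sink hs) (hRK.not_blocked_of_sink hs)).resolve_left
        fun h => hL v h (hR.simplicial_of_sink hs)
    obtain ⟨v, hv, hs⟩ := exists_sink hR₀.acyclic ⟨X, hXA⟩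
    obtain ⟨-, c, hc, hcA⟩ := hlast R₀ hR₀ hR₀K v hv hs
    obtain ⟨R, hR, hRK, hXc⟩ := hC c hc
    obtain ⟨x, hx, hcx, hs⟩ := exists_sink_reachable hR.acyclic hcA
    obtain ⟨rfl, -⟩ := hlast R hR hRK x hx hs
    exact hR.asymm hXc (hR.dir_of_reach hcx (hsymm _ _ (hUC c hc)))
  obtain ⟨u, hu, hsu⟩ := hL
  have huA := hBA hu
  have huX : U X u := hUB u hu
  obtain ⟨M, hM⟩ : ∃ M : Set V, ∀ v, v ∈ M ↔ v ∈ A ∧ (v = u ∨ U v u) := ⟨{v | _}, fun _ => Iff.rfl⟩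
  have hMU : ∀ a ∈ M, ∀ b ∈ M, a ≠ b → U a b := by
    intro a ha b hb hab
    obtain ⟨ha, rfl | hau⟩ := (hM a).1 ha <;> obtain ⟨hb, rfl | hbu⟩ := (hM b).1 hb
    · exact (hab rfl).elim
    · exact hsymm _ _ hbu
    · exact hau
    · exact hsu a ha b hb hau hbu hab
  have huM : u ∈ M := (hM u).2 ⟨huA, Or.inl rfl⟩
  have hXM : X ∈ M := (hM X).2 ⟨hXA, Or.inr huX⟩
  have hBM : B ⊆ M := fun v hv => (hM v).2 ⟨hBA hv, or_iff_not_imp_left.2 (hBU v hv u hu)⟩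
  have hMA : M ⊆ A := fun v hv => ((hM v).1 hv).1
  have hnbr : ∀ v ∈ M, Simplicial U A v → ∀ y ∈ A, U y v → y ∈ M := by
    intro v hv hsv y hy hyv
    by_cases hyu : y = u
    · exact hyu ▸ huM
    by_cases hvu : v = u
    · exact (hM y).2 ⟨hy, Or.inr (hvu ▸ hyv)⟩
    · exact (hM y).2 ⟨hy, Or.inr (hsv y hy u huA hyv (hMU u huM v hv (Ne.symm hvu)) hyu)⟩
  have hleafM : ∀ v ∈ A, Simplicial U A v → ¬ Blocked K A v → v ∈ M := by
    intro v hv hs hn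
    rcases hleaf v hv hs hn with h | ⟨rfl, -⟩
    · exact hBM h
    · exact hXM
  have hsim : ∀ v ∈ M, (∀ y ∈ A, U v y → y ∈ M) → Simplicial U A v :=
    fun v hv h a ha b hb hav hbv hab =>
      hMU a (h a ha (hsymm _ _ hav)) b (h b hb (hsymm _ _ hbv)) hab
  -- A neighbour of `X` in `A \ M` would force `X → u`, yet some admissible orientation has `u → X`.
  have hsX : Simplicial U A X := by
    refine hsim X hXM fun y hy hXy => ?_
    by_contra hyM
    obtain ⟨R, hR, hRK, huX'⟩ := hB u hu
    exact hR.asymm huX' (hR.dir_of_exit hRK hsymm hleafM hMU hXM hy hyM hXy huM (hnbr u huM hsu))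
  obtain ⟨w, hw, hwn⟩ := hcl M hXM hBM hMU
  have hwB : w ∉ B := fun h => hwn (blockB h hXM)
  by_cases hsw : Simplicial U A w
  · by_cases hwK : Blocked K A w
    · obtain ⟨κ, hκ, rfl, hsub⟩ := hwK
      exact hwn ⟨κ, Or.inl hκ, rfl, fun h hh =>
        hnbr _ hw hsw h (hsub hh) (hsymm _ _ (hK κ hκ h hh))⟩
    · rcases hleaf w (hMA hw) hsw hwK with h | ⟨rfl, c, hc, hcA⟩
      · exact hwB h
      · exact hwn (blockC hc (hnbr w hw hsX c hcA (hsymm _ _ (hUC c hc))))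
  -- Here `w` has a neighbour in `A \ M`, which forces `w → X`; but `w ∈ C`, and `X → w` is
  -- attainable.
  · have hwX : w ≠ X := by
      rintro rfl
      exact hsw hsX
    obtain ⟨y, hy, hwy, hyM⟩ : ∃ y ∈ A, U w y ∧ y ∉ M := by
      by_contra! h
      exact hsw (hsim w hw h)
    rcases (hBC w).1 (hMU X hXM w hw hwX.symm) with h | h
    · exact hwB h
    · obtain ⟨R, hR, hRK, hXw⟩ := hC w h
      exact hR.asymm hXw
        (hR.dir_of_exit hRK hsymm hleafM hMU hw hy hyM hwy hXM (hnbr X hXM hsX))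

end Cliques
end MixedGraph

/-! ### Translation to MPDAGs and local clause sets -/

namespace MixedGraph

section LocalConditions

variable {V : Type*} {P H : MixedGraph V} {K D D' : Set (DCC V)} {X : V} {S : Set V}

theorem Blocked.mono {A : Set V} {v : V} (hD : D ⊆ D') (h : Blocked D A v) : Blocked D' A v := by
  obtain ⟨κ, hκ, htail, hsub⟩ := h
  exact ⟨κ, hD hκ, htail, hsub⟩

theorem undir_of_undir_of_isMPDAGOf (hH : H.IsMPDAGOf P K) {a b : V} (h : H.undir a b) :
    P.undir a b := by
  have hdir : ∀ {a b}, P.dir a b → H.dir a b := fun h =>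
    (hH.2.2.2 _ _).2 fun G hG => dir_of_mem_markovClass hG.1 h
  rcases (hH.2.1.2 a b).1 (Or.inr (Or.inr h)) with h' | h' | h'
  · exact (H.dir_not_undir (hdir h') h).elim
  · exact (H.dir_not_undir (hdir h') (H.undir_symm h)).elim
  · exact h'

theorem exists_dir_of_undir (hH : H.IsMPDAGOf P K) {a b : V} (h : H.undir a b) :
    ∃ G ∈ P.restrictedClass K, G.dir a b := by
  have hn : ¬ H.dir b a := fun h' => H.dir_not_undir h' (H.undir_symm h)
  rw [hH.2.2.2 b a] at hn
  push Not at hn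
  obtain ⟨G, hG, hn⟩ := hn
  exact ⟨G, hG, (hG.1.1.dir_or_dir ((adj_iff_of_mem_markovClass hG.1).1
    ((hH.2.1.2 a b).1 (Or.inr (Or.inr h))))).resolve_right hn⟩

/-- One-head clauses along undirected edges survive reduction unchanged. This inclusion suffices,
since blocking is monotone in the clause set. -/
theorem reducedForm_union_starClauses_subset :
    P.reducedForm K ∪ starClauses X ((H.pa X ∪ S) ∩ P.sib X)
        (((H.sib X ∪ H.ch X) \ S) ∩ P.sib X) ⊆
      P.reducedForm (K ∪ H.orientationClauses X S) := by
  have single : ∀ {κ : DCC V} {v}, κ.heads = {v} → P.undir κ.tail v →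
      κ.heads ∩ P.ch κ.tail = ∅ ∧ κ.heads = κ.heads ∩ P.sib κ.tail := by
    intro κ v hκ h
    rw [hκ]
    exact ⟨Set.singleton_inter_eq_empty.2 fun h' => P.dir_not_undir h' h,
      (Set.inter_eq_left.2 (Set.singleton_subset_iff.2 h)).symm⟩
  rintro κ (⟨κ₀, hκ₀, h⟩ | ⟨⟨hB, hsib⟩, hX⟩ | ⟨hX, c, ⟨hc, hsib⟩, hcκ⟩)
  · exact ⟨κ₀, Or.inl hκ₀, h⟩
  · have := single hX (P.undir_symm hsib)
    exact ⟨κ, Or.inr (Or.inl ⟨hB, hX⟩), this.1, rfl, this.2⟩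
  · have := single hcκ (hX ▸ hsib)
    exact ⟨κ, Or.inr (Or.inr ⟨hX, c, hc, hcκ⟩), this.1, rfl, this.2⟩

/-- The prescribed directions at `X` are realized by a DAG of the restricted class if the
prescribed parents form a clique and the clauses can be satisfied on cliques. -/
theorem exists_mem_restrictedClass_of_cliques [Finite V] (hK : P.Consistent K)
    (hH : H.IsMPDAGOf P K) (hS : S ⊆ H.sib X)
    (hBU : ∀ a ∈ (H.pa X ∪ S) ∩ P.sib X, ∀ b ∈ (H.pa X ∪ S) ∩ P.sib X, a ≠ b → P.undir a b)
    (hcl : ∀ M : Set V, X ∈ M → (H.pa X ∪ S) ∩ P.sib X ⊆ M →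
      (∀ a ∈ M, ∀ b ∈ M, a ≠ b → P.undir a b) →
      ∃ w ∈ M, ¬ Blocked (P.reducedForm (K ∪ H.orientationClauses X S)) M w) :
    ∃ G ∈ P.restrictedClass K, G.pa X = S ∪ H.pa X ∧ G.ch X = (H.sib X ∪ H.ch X) \ S := by
  obtain ⟨G₀, hG₀⟩ := hK
  have orient : ∀ G ∈ P.restrictedClass K,
      IsMoralOrientation P.undir (fun a b => G.dir a b ∧ P.undir a b) ∧
        Satisfies (fun a b => G.dir a b ∧ P.undir a b) (P.reducedForm K) := fun G hG =>
    ⟨isMoralOrientation_of_mem_markovClass hG.1, holds_reducedForm hG⟩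
  have hSP : ∀ v ∈ S, P.undir X v := fun v hv => undir_of_undir_of_isMPDAGOf hH (hS hv)
  have hPH : ∀ {a b}, P.dir a b → H.dir a b := fun h =>
    (hH.2.2.2 _ _).2 fun G hG => dir_of_mem_markovClass hG.1 h
  obtain ⟨R, hR, hRK⟩ := exists_moralOrientation_of_cliques (U := P.undir)
    (K := P.reducedForm K) (X := X) (B := (H.pa X ∪ S) ∩ P.sib X)
    (C := ((H.sib X ∪ H.ch X) \ S) ∩ P.sib X) (fun _ _ => P.undir_symm) P.undir_irrefl
    (by
      rintro κ ⟨κ₀, -, -, htail, hheads⟩ h hh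
      rw [hheads] at hh
      exact htail ▸ hh.2)
    (by
      refine fun v => ⟨fun h => ?_, fun h => h.elim And.right And.right⟩
      by_cases hv : v ∈ S
      · exact Or.inl ⟨Or.inr hv, h⟩
      rcases (hH.2.1.2 X v).2 (Or.inr (Or.inr h)) with h' | h' | h'
      · exact Or.inr ⟨⟨Or.inr h', hv⟩, h⟩
      · exact Or.inl ⟨Or.inl h', h⟩
      · exact Or.inr ⟨⟨Or.inl h', hv⟩, h⟩)
    ⟨_, orient G₀ hG₀⟩
    (by
      rintro u ⟨hu | hu, hsib⟩
      · exact ⟨_, (orient G₀ hG₀).1, (orient G₀ hG₀).2, (hH.2.2.2 _ _).1 hu G₀ hG₀,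
          P.undir_symm hsib⟩
      · obtain ⟨G, hG, h⟩ := exists_dir_of_undir hH (H.undir_symm (hS hu))
        exact ⟨_, (orient G hG).1, (orient G hG).2, h, P.undir_symm hsib⟩)
    (by
      rintro v ⟨⟨hv | hv, -⟩, hsib⟩
      · obtain ⟨G, hG, h⟩ := exists_dir_of_undir hH hv
        exact ⟨_, (orient G hG).1, (orient G hG).2, h, hsib⟩
      · exact ⟨_, (orient G₀ hG₀).1, (orient G₀ hG₀).2, (hH.2.2.2 _ _).1 hv G₀ hG₀, hsib⟩)
    hBU
    (fun M hX hB hM => by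
      obtain ⟨w, hw, hn⟩ := hcl M hX hB hM
      exact ⟨w, hw, fun h => hn (h.mono reducedForm_union_starClauses_subset)⟩)
  obtain ⟨G, hG, hdir⟩ := exists_mem_markovClass_of_isMoralOrientation hG₀.1 hR
  have hin : ∀ u ∈ S ∪ H.pa X, G.dir u X := by
    intro u hu
    have star : P.undir X u → G.dir u X := by
      intro h
      obtain ⟨x, hx, hRx⟩ := hRK ⟨u, {X}, fun h' => by
        obtain rfl : u = X := h'
        exact P.undir_irrefl _ h⟩ (Or.inr (Or.inl ⟨⟨hu.symm, h⟩, rfl⟩))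
      obtain rfl : x = X := hx
      exact (hdir _ _).2 (Or.inr hRx)
    rcases hu with hu | hu
    · exact star (hSP u hu)
    · rcases (hH.2.1.2 u X).1 (Or.inl hu) with h | h | h
      · exact dir_of_mem_markovClass hG h
      · exact (H.dir_asymm hu (hPH h)).elim
      · exact star (P.undir_symm h)
  have hout : ∀ v ∈ (H.sib X ∪ H.ch X) \ S, G.dir X v := by
    intro v hv
    have star : P.undir X v → G.dir X v := by
      intro h
      obtain ⟨x, hx, hRx⟩ := hRK ⟨X, {v}, fun h' => by
        obtain rfl : X = v := h'
        exact P.undir_irrefl _ h⟩ (Or.inr (Or.inr ⟨rfl, v, ⟨hv, h⟩, rfl⟩))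
      obtain rfl : x = v := hx
      exact (hdir _ _).2 (Or.inr hRx)
    rcases hv.1 with h' | h'
    · exact star (undir_of_undir_of_isMPDAGOf hH h')
    · rcases (hH.2.1.2 X v).1 (Or.inl h') with h | h | h
      · exact dir_of_mem_markovClass hG h
      · exact (H.dir_asymm h' (hPH h)).elim
      · exact star h
  have cover : ∀ {v}, G.Adj X v → v ∈ S ∪ H.pa X ∨ v ∈ (H.sib X ∪ H.ch X) \ S := by
    intro v h
    by_cases hv : v ∈ S
    · exact Or.inl (Or.inl hv)
    rcases (hH.2.1.2 X v).2 ((adj_iff_of_mem_markovClass hG).2 h) with h' | h' | h'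
    · exact Or.inr ⟨Or.inr h', hv⟩
    · exact Or.inl (Or.inr h')
    · exact Or.inr ⟨Or.inl h', hv⟩
  refine ⟨G, ⟨hG, fun κ hκ => ?_⟩, Set.Subset.antisymm (fun v hv => ?_) hin,
    Set.Subset.antisymm (fun v hv => ?_) hout⟩
  -- Clauses dropped by the reduction hold in every DAG of the class.
  · rcases Set.eq_empty_or_nonempty (κ.heads ∩ P.ch κ.tail) with he | ⟨h, hh, hch⟩
    · obtain ⟨h, hh, hRh⟩ := hRK ⟨κ.tail, κ.heads ∩ P.sib κ.tail,
        fun h => κ.tail_notMem h.1⟩ (Or.inl ⟨κ, hκ, he, rfl, rfl⟩)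
      exact ⟨h, hh.1, (hdir _ _).2 (Or.inr hRh)⟩
    · exact ⟨h, hh, dir_of_mem_markovClass hG hch⟩
  · exact (cover (Or.inr (Or.inl hv))).resolve_right fun h => G.dir_asymm hv (hout v h)
  · exact (cover (Or.inl hv)).resolve_left fun h => G.dir_asymm hv (hin v h)

theorem mem_restrictedClass_union_orientationClauses {G : MixedGraph V}
    (hG : G ∈ P.restrictedClass K) (hpa : G.pa X = S ∪ H.pa X)
    (hch : G.ch X = (H.sib X ∪ H.ch X) \ S) :
    G ∈ P.restrictedClass (K ∪ H.orientationClauses X S) := by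
  refine ⟨hG.1, ?_⟩
  rintro κ (hκ | ⟨hκ, hX⟩ | ⟨hX, c, hc, hcκ⟩)
  · exact hG.2 κ hκ
  · refine ⟨X, hX ▸ rfl, ?_⟩
    have : κ.tail ∈ G.pa X := hpa ▸ hκ.symm
    exact this
  · refine ⟨c, hcκ ▸ rfl, ?_⟩
    rw [hX, hch]
    exact hc

/-- The prescribed parents of `X` form a clique if the ones that are siblings in `H` do. -/
theorem undir_of_isClique [Finite V] (hK : P.Consistent K) (hH : H.IsMPDAGOf P K)
    (hS : S ⊆ H.sib X) (hc : H.IsClique S) :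
    ∀ a ∈ (H.pa X ∪ S) ∩ P.sib X, ∀ b ∈ (H.pa X ∪ S) ∩ P.sib X, a ≠ b → P.undir a b := by
  have common : ∀ G ∈ P.restrictedClass K, ∀ a b, P.undir X a → P.undir X b → G.dir a X →
      G.dir b X → a ≠ b → P.undir a b := fun G hG a b ha hb haX hbX hab =>
    (isMoralOrientation_of_mem_markovClass hG.1).moral ⟨haX, P.undir_symm ha⟩
      ⟨hbX, P.undir_symm hb⟩ hab
  -- A DAG with `b → X` exists as this edge is undirected in `H`; `a → X` holds in all of them, so
  -- morality applies.
  have mixed : ∀ a b, P.undir X a → P.undir X b → a ∈ H.pa X → b ∈ S → a ≠ b → P.undir a b := by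
    intro a b ha hb hap hbS hab
    obtain ⟨G, hG, h⟩ := exists_dir_of_undir hH (H.undir_symm (hS hbS))
    exact common G hG a b ha hb ((hH.2.2.2 _ _).1 hap G hG) h hab
  obtain ⟨G₀, hG₀⟩ := hK
  rintro a ⟨ha | ha, ha'⟩ b ⟨hb | hb, hb'⟩ hab
  · exact common G₀ hG₀ a b ha' hb' ((hH.2.2.2 _ _).1 ha G₀ hG₀) ((hH.2.2.2 _ _).1 hb G₀ hG₀) hab
  · exact mixed a b ha' hb' ha hb hab
  · exact P.undir_symm (mixed b a hb' ha' hb ha hab.symm)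
  · exact undir_of_adj_of_undir hG₀.1 (P.undir_symm ha') (P.undir_symm hb')
      ((hH.2.1.2 a b).1 (hc.2 a ha b hb hab))

theorem IsClique.exists_isMaximalClique [Finite V] {M : Set V} (hM : P.IsClique M) :
    ∃ M', P.IsMaximalClique M' ∧ M ⊆ M' := by
  obtain ⟨M', hMM', hmax⟩ := (Set.toFinite {M | P.IsClique M}).exists_le_maximal hM
  exact ⟨M', ⟨hmax.prop, fun B hB h => (hmax.eq_of_le hB h).symm⟩, hMM'⟩

end LocalConditions
end MixedGraph

/-! ### The equivalence -/

theorem mainTheorem9 {V : Type*} [Finite V] (Gs : MixedGraph V) (hGs : Gs.IsCPDAG)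
    (K : Set (DCC V)) (hKover : ∀ κ ∈ K, κ.IsOver Gs.verts) (hK : Gs.Consistent K)
    (H : MixedGraph V) (hH : H.IsMPDAGOf Gs K)
    (X : V) (hX : X ∈ Gs.verts) (S : Set V) (hS : S ⊆ H.sib X) :
    List.TFAE [
      -- (i) some DAG of the restricted class has the prescribed parents and children of `X`
      ∃ G ∈ Gs.restrictedClass K,
        G.pa X = S ∪ H.pa X ∧ G.ch X = (H.sib X ∪ H.ch X) \ S,
      -- (ii) `S` is complete in `H`, and the clauses are consistent on each maximal clique
      -- of `Gs` that contains `X` and `(pa(X, H) ∪ S) ∩ sib(X, Gs)`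
      H.IsClique S ∧
        ∀ M : Set V, Gs.IsMaximalClique M → {X} ∪ ((H.pa X ∪ S) ∩ Gs.sib X) ⊆ M →
          (Gs.undirInduce M).Consistent
            (Gs.restrictionSubset (K ∪ H.orientationClauses X S) (Gs.undirInduce M)),
      -- (iii) the clauses are consistent on `X` together with its siblings in `Gs`
      (Gs.undirInduce ({X} ∪ Gs.sib X)).Consistent
        (Gs.restrictionSubset (K ∪ H.orientationClauses X S)
          (Gs.undirInduce ({X} ∪ Gs.sib X)))] := by
  obtain ⟨G₀, hG₀⟩ := hK
  have hSP : ∀ v ∈ S, Gs.undir X v := fun v hv =>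
    MixedGraph.undir_of_undir_of_isMPDAGOf hH (hS hv)
  have verts : ∀ {M : Set V}, X ∈ M → (∀ a ∈ M, ∀ b ∈ M, a ≠ b → Gs.undir a b) →
      M ⊆ Gs.verts := by
    intro M hXM hM v hv
    by_cases h : v = X
    · exact h ▸ hX
    · exact (Gs.undir_mem (hM v hv X hXM h)).1
  tfae_have 1 → 2 := by
    rintro ⟨G, hG, hpa, hch⟩
    refine ⟨⟨fun v hv => (H.undir_mem (hS hv)).2, fun a ha b hb hab => ?_⟩, fun M _ _ =>
      MixedGraph.consistent_undirInduce
        (MixedGraph.mem_restrictedClass_union_orientationClauses hG hpa hch) M⟩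
    have hin : ∀ u ∈ S, G.dir u X ∧ Gs.undir u X := fun u hu =>
      ⟨show u ∈ G.pa X from hpa ▸ Or.inl hu, Gs.undir_symm (hSP u hu)⟩
    exact (hH.2.1.2 a b).2 (Or.inr (Or.inr
      ((MixedGraph.isMoralOrientation_of_mem_markovClass hG.1).moral (hin a ha) (hin b hb) hab)))
  tfae_have 1 → 3 := by
    rintro ⟨G, hG, hpa, hch⟩
    exact MixedGraph.consistent_undirInduce
      (MixedGraph.mem_restrictedClass_union_orientationClauses hG hpa hch) _
  tfae_have 2 → 1 := by
    rintro ⟨hc, hcons⟩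
    refine MixedGraph.exists_mem_restrictedClass_of_cliques ⟨G₀, hG₀⟩ hH hS
      (MixedGraph.undir_of_isClique ⟨G₀, hG₀⟩ hH hS hc) fun M hXM hBM hM => ?_
    have hclique : Gs.IsClique M := ⟨verts hXM hM, fun a ha b hb hab => Or.inr (Or.inr
      (hM a ha b hb hab))⟩
    obtain ⟨M', hM', hMM'⟩ := hclique.exists_isMaximalClique
    exact MixedGraph.exists_not_blocked_of_consistent
      (hcons M' hM' (Set.union_subset (Set.singleton_subset_iff.2 (hMM' hXM)) (hBM.trans hMM')))
      (Set.subset_inter (verts hXM hM) hMM') ⟨X, hXM⟩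
  tfae_have 3 → 1 := by
    intro hcons
    refine MixedGraph.exists_mem_restrictedClass_of_cliques ⟨G₀, hG₀⟩ hH hS ?_
      fun M hXM hBM hM => MixedGraph.exists_not_blocked_of_consistent hcons
        (Set.subset_inter (verts hXM hM) fun v hv => or_iff_not_imp_left.2
          fun h => hM X hXM v hv (Ne.symm h)) ⟨X, hXM⟩
    obtain ⟨O, hO, hOK⟩ := hcons
    have hR := MixedGraph.isMoralOrientation_of_mem_markovClass hO
    -- Completeness of the prescribed parents is not assumed in (iii): the local DAG directs them
    -- all into `X` and has no v-structure.
    have hin : ∀ u ∈ (H.pa X ∪ S) ∩ Gs.sib X, O.dir u X ∧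
        (Gs.undirInduce ({X} ∪ Gs.sib X)).undir u X := by
      rintro u ⟨hu, hsib⟩
      have hsib : Gs.undir X u := hsib
      have hne : u ∉ ({X} : Set V) := by
        rintro rfl
        exact Gs.undir_irrefl _ hsib
      obtain ⟨x, hx, hdir⟩ := hOK ⟨u, {X}, hne⟩
        ⟨MixedGraph.reducedForm_union_starClauses_subset (Or.inr (Or.inl ⟨⟨hu, hsib⟩, rfl⟩)),
          ⟨(Gs.undir_mem hsib).2, Or.inr hsib⟩,
          Set.singleton_subset_iff.2 ⟨hX, Or.inl rfl⟩⟩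
      obtain rfl : x = X := hx
      exact ⟨hdir, Gs.undir_symm hsib, Or.inr hsib, Or.inl rfl⟩
    exact fun a ha b hb hab => (hR.moral (hin a ha) (hin b hb) hab).1
  tfae_finish
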